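/- **Plausibility spaces.** A plausibility space is a pair $S=(\Omega,\mathrm{Pl})$, where $\mathrm{Pl}$ maps the subsets of $\Omega$ to a partially ordered set with least element $\bot$ and greatest element $\top$ (possibly $\bot=\top$), $\mathrm{Pl}(\emptyset)=\bot$, $\mathrm{Pl}(\Omega)=\top$, and $A\subseteq B$ implies $\mathrm{Pl}(A)\le \mathrm{Pl}(B)$. The domain of values is not part of the space: two spaces are equal if they have the same $\Omega$ and induce the same ordering $\mathrm{Pl}(A)\le\mathrm{Pl}(B)$ on subsets of $\Omega$. $S$ is *qualitative* if (A2) for pairwise disjoint $A,B,C$, $\mathrm{Pl}(A\cup B)>\mathrm{Pl}(C)$ and $\mathrm{Pl}(A\cup C)>\mathrm{Pl}(B)$ imply $\mathrm{Pl}(A)>\mathrm{Pl}(B\cup C)$, and (A3) $\mathrm{Pl}(A)=\mathrm{Pl}(B)=\bot$ implies $\mathrm{Pl}(A\cup B)=\bot$. It is a *ranking* if any two values $\mathrm{Pl}(A),\mathrm{Pl}(B)$ are comparable and $\mathrm{Pl}(A\cup B)=\max(\mathrm{Pl}(A),\mathrm{Pl}(B))$. **Systems.** Fix agents $1,\dots,n$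 and a set of primitive propositions. An interpreted plausibility system $\mathcal I=(\mathcal R,\pi,\mathcal P_1,\dots,\mathcal P_n)$ consists of a set $\mathcal R$ of runs (functions from $\mathbb N$ to global states, a global state being an environment state together with a local state for each agent), a truth assignment $\pi$ to the primitive propositions at each global state, and, for each agent $i$ and each point $(r,m)\in\mathcal R\times\mathbb N$, a plausibility space $\mathcal P_i(r,m)=(\Omega_{(r,m,i)},\mathrm{Pl}_{(r,m,i)})$ with $\Omega_{(r,m,i)}$ a set of points. Write $r_i(m)$ for agent $i$'s local state at $(r,m)$, $(r,m)\sim_i(r',m')$ if $r_i(m)=r'_i(m')$, $\mathcal K_i(r,m)$ for the set of points $\sim_i$-equivalent to $(r,m)$, and $\mathcal R(A)$ for the set of runs on which the points of a set $A$ lie. **Language.** Formulas of $\mathcal L^{KCT}$ are built from primitive propositions with $\neg$, $\wedge$, $K_i$, $\to_i$ and $\bigcirc$. $K_i\varphi$ holds at $(r,m)$ if $\varphi$ holds at all points of $\mathcal K_i(r,m)$; $\bigcirc\varphi$ holds at $(r,m)$ if $\varphi$ holds at $(r,m+1)$; and $\varphi\to_i\psi$ holds at $(r,m)$ if $\mathrm{Pl}_{(r,m,i)}([\![\varphi]\!])=\bot$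 or $\mathrm{Pl}_{(r,m,i)}([\![\varphi\wedge\psi]\!])>\mathrm{Pl}_{(r,m,i)}([\![\varphi\wedge\neg\psi]\!])$, where $[\![\chi]\!]$ is the set of points of $\Omega_{(r,m,i)}$ at which $\chi$ holds. A formula is *temporally linear* if $\bigcirc$ does not occur in it in the scope of any $K_i$ or $\to_i$. **Conditions** (for all agents $i$, points $p$, runs $r,r'$, times $m$): - QUAL: $\mathcal P_i(p)$ is qualitative. RANK: $\mathcal P_i(p)$ is a ranking. NORM: $\top>\bot$ in $\mathcal P_i(p)$. - REF: $p\in\Omega_{(p,i)}$, and $\mathrm{Pl}_{(p,i)}(A)>\bot$ whenever $p\in A\subseteq\Omega_{(p,i)}$. - CONS: $\Omega_{(p,i)}\subseteq\mathcal K_i(p)$. - SDP: $\mathcal P_i(p)=\mathcal P_i(q)$ for all $q\in\mathcal K_i(p)$. UNIF: $\mathcal P_i(p)=\mathcal P_i(q)$ for all $q\in\Omega_{(p,i)}$. - Synchrony: $(r,m)\sim_i(r',m')$ only if $m=m'$. Perfect recall (for synchronous systems): $(r',m+1)\sim_i(r,m+1)$ implies $(r',m)\sim_i(r,m)$. - Coherence: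 if $R\subseteq\mathcal R$, $A\subseteq\Omega_{(r,m,i)}$, $\mathcal R(A)=R\cap\mathcal R(\Omega_{(r,m,i)})$, $A'\subseteq\Omega_{(r,m+1,i)}$, $\mathcal R(A')=R\cap\mathcal R(\Omega_{(r,m+1,i)})$ and $\mathrm{Pl}_{(r,m,i)}(A)=\bot$, then $\mathrm{Pl}_{(r,m+1,i)}(A')=\bot$. - PERSIST: if $(r,m+1)\sim_i(r',m+1)$, then $\mathcal P_i(r,m+1)=\mathcal P_i(r',m+1)$ if and only if $\mathcal P_i(r,m)=\mathcal P_i(r',m)$. - PRIOR: the system is synchronous, and for each $r$ and $i$ there is a plausibility space $(\mathcal R_{(r,i)},\mathrm{Pl}_{(r,i)})$ with $\mathcal R_{(r,i)}\subseteq\mathcal R$ (the prior) such that for all $m$, $\Omega_{(r,m,i)}=\{(r',m)\in\mathcal K_i(r,m):r'\in\mathcal R_{(r,i)}\}$ and $\mathrm{Pl}_{(r,m,i)}(A)=\mathrm{Pl}_{(r,i)}|_{\mathcal R(\mathcal K_i(r,m))}(\mathcal R(A))$ for all $A\subseteq\Omega_{(r,m,i)}$ (equality as plausibility measures, that is, the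 two sides order the sets $A$ in the same way), where $\mathrm{Pl}|_E$ is the restriction of $\mathrm{Pl}$ to subsets of $E$. **Theorem.** Let $\mathcal A$ be a subset of $\{\mathrm{QUAL},\mathrm{NORM},\mathrm{REF},\mathrm{SDP},\mathrm{UNIF},\mathrm{RANK}\}$ and let $\mathcal I$ be a coherent synchronous system satisfying perfect recall, CONS, PERSIST, and every condition in $\mathcal A$. Then there are a synchronous system $\mathcal I'$ satisfying perfect recall, PRIOR, and every condition in $\mathcal A$, and a mapping $f:\mathcal R\to\mathcal R'$, such that for all temporally linear formulas $\varphi\in\mathcal L^{KCT}$ and all points $(r,m)$ of $\mathcal I$, $(\mathcal I,r,m)\models\varphi$ if and only if $(\mathcal I',f(r),m)\models\varphi$. -/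

import Mathlib

universe u v

/-- A plausibility space over subsets of `W`: an underlying set `carrier ⊆ W`, a pointed partially
ordered domain `D` of plausibility values, and a monotone assignment of values to the subsets of
`carrier` with `Pl ∅ = ⊥` and `Pl carrier = ⊤` (where `⊥ = ⊤` is allowed).
All subsets of `carrier` are measurable; the values of `Pl` at other sets are never used. -/
structure PlausibilitySpace (W : Type u) : Type (u + 1) where
  carrier : Set W
  D : Type u
  [order : PartialOrder D]
  [bounded : BoundedOrder D]
  Pl : Set W → D
  Pl_empty : Pl ∅ = ⊥
  Pl_carrier : Pl carrier = ⊤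
  mono : ∀ A B : Set W, A ⊆ B → B ⊆ carrier → Pl A ≤ Pl B

attribute [instance] PlausibilitySpace.order PlausibilitySpace.bounded

namespace PlausibilitySpace

variable {W : Type u}

/-- Identity of plausibility spaces.  The domain of values is not part of a plausibility space,
only the ordering that it induces on sets is, so two spaces are the same when they have the same
underlying set and order its subsets in the same way. -/
def Same (S T : PlausibilitySpace W) : Prop :=
  S.carrier = T.carrier ∧
    ∀ A B : Set W, A ⊆ S.carrier → B ⊆ S.carrier → (S.Pl A ≤ S.Pl B ↔ T.Pl A ≤ T.Pl B)

/-- The projection of `S` on `E`: the underlying set is `carrier ∩ E`, and `Pl` is restricted to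
the subsets of it.  The domain is cut down to the values below that of `carrier ∩ E`, which becomes
the top element. -/
def proj (S : PlausibilitySpace W) (E : Set W) : PlausibilitySpace W where
  carrier := S.carrier ∩ E
  D := Set.Iic (S.Pl (S.carrier ∩ E))
  bounded :=
    { top := ⟨S.Pl (S.carrier ∩ E), le_refl _⟩
      le_top := fun a => a.2
      bot := ⟨⊥, bot_le⟩
      bot_le := fun _ => bot_le (α := S.D) }
  Pl := fun A => ⟨S.Pl (A ∩ (S.carrier ∩ E)),
    S.mono _ _ Set.inter_subset_right Set.inter_subset_left⟩
  Pl_empty := Subtype.ext (by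
    show S.Pl (∅ ∩ (S.carrier ∩ E)) = ⊥
    rw [Set.empty_inter, S.Pl_empty])
  Pl_carrier := Subtype.ext (by
    show S.Pl ((S.carrier ∩ E) ∩ (S.carrier ∩ E)) = S.Pl (S.carrier ∩ E)
    rw [Set.inter_self])
  mono := fun A B h _ => S.mono (A ∩ (S.carrier ∩ E)) (B ∩ (S.carrier ∩ E))
    (Set.inter_subset_inter_left _ h) (Set.inter_subset_right.trans Set.inter_subset_left)

/-- Qualitative plausibility spaces: conditions A2 and A3. -/
def Qualitative (S : PlausibilitySpace W) : Prop :=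
  (∀ A B C : Set W, A ⊆ S.carrier → B ⊆ S.carrier → C ⊆ S.carrier →
      Disjoint A B → Disjoint A C → Disjoint B C →
      S.Pl C < S.Pl (A ∪ B) → S.Pl B < S.Pl (A ∪ C) → S.Pl (B ∪ C) < S.Pl A) ∧
  (∀ A B : Set W, A ⊆ S.carrier → B ⊆ S.carrier →
      S.Pl A = ⊥ → S.Pl B = ⊥ → S.Pl (A ∪ B) = ⊥)

/-- Rankings: the values of any two sets are comparable, and the value of `A ∪ B` is the maximum of
those of `A` and `B`. -/
def IsRanking (S : PlausibilitySpace W) : Prop :=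
  ∀ A B : Set W, A ⊆ S.carrier → B ⊆ S.carrier →
    (S.Pl A ≤ S.Pl B ∨ S.Pl B ≤ S.Pl A) ∧ IsGreatest {S.Pl A, S.Pl B} (S.Pl (A ∪ B))

end PlausibilitySpace

/-- The language of knowledge, conditional plausibility and time for agents `i : Fin n` and
primitive propositions `Φ`. -/
inductive Formula (n : ℕ) (Φ : Type v) : Type v
  | prim (p : Φ) : Formula n Φ
  | neg (φ : Formula n Φ) : Formula n Φ
  | conj (φ ψ : Formula n Φ) : Formula n Φ
  | know (i : Fin n) (φ : Formula n Φ) : Formula n Φ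
  | cond (i : Fin n) (φ ψ : Formula n Φ) : Formula n Φ
  | next (φ : Formula n Φ) : Formula n Φ

namespace Formula

variable {n : ℕ} {Φ : Type v}

/-- The formula contains no temporal modality. -/
def TimeFree : Formula n Φ → Prop
  | prim _ => True
  | neg φ => φ.TimeFree
  | conj φ ψ => φ.TimeFree ∧ ψ.TimeFree
  | know _ φ => φ.TimeFree
  | cond _ φ ψ => φ.TimeFree ∧ ψ.TimeFree
  | next _ => False

/-- No temporal modality occurs in the scope of a knowledge or conditional modality. -/
def TemporallyLinear : Formula n Φ → Prop
  | prim _ => True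
  | neg φ => φ.TemporallyLinear
  | conj φ ψ => φ.TemporallyLinear ∧ ψ.TemporallyLinear
  | know _ φ => φ.TimeFree
  | cond _ φ ψ => φ.TimeFree ∧ ψ.TimeFree
  | next φ => φ.TemporallyLinear

end Formula

/-- An interpreted plausibility system with agents `i : Fin n`.  A global state is an environment
state together with a local state for each agent, a run is a function from time to global states,
and a point is a run of the system together with a time.  `val` is the truth assignment at each
global state, and `pl i` is the plausibility assignment of agent `i`. -/
structure InterpretedSystem (n : ℕ) (Φ : Type v) : Type (max (u + 1) v) where
  Env : Type u
  Loc : Fin n → Type u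
  runs : Set (ℕ → Env × (∀ i, Loc i))
  val : Env × (∀ i, Loc i) → Φ → Prop
  pl : Fin n → ↥runs × ℕ → PlausibilitySpace (↥runs × ℕ)

namespace InterpretedSystem

variable {n : ℕ} {Φ : Type v} (I : InterpretedSystem.{u, v} n Φ)

abbrev Run : Type u := ↥I.runs

abbrev Point : Type u := I.Run × ℕ

/-- The local state of agent `i` at a point. -/
def localState (i : Fin n) (p : I.Point) : I.Loc i := (p.1.1 p.2).2 i

/-- The points that agent `i` considers possible at `p`: those at which her local state is the same
as at `p`. -/
def poss (i : Fin n) (p : I.Point) : Set I.Point := {q | I.localState i q = I.localState i p}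

/-- The set of points to which agent `i` assigns a degree of plausibility at `p`. -/
def Om (i : Fin n) (p : I.Point) : Set I.Point := (I.pl i p).carrier

/-- The set of runs on which the points in `A` lie. -/
def runsOf (A : Set I.Point) : Set I.Run := {r | ∃ m, (r, m) ∈ A}

/-- Truth of a formula at a point. -/
def Sat : I.Point → Formula n Φ → Prop
  | p, .prim a => I.val (p.1.1 p.2) a
  | p, .neg φ => ¬ Sat p φ
  | p, .conj φ ψ => Sat p φ ∧ Sat p ψ
  | p, .know i φ => ∀ q ∈ I.poss i p, Sat q φ
  | p, .cond i φ ψ =>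
      (I.pl i p).Pl {q | q ∈ I.Om i p ∧ Sat q φ} = ⊥ ∨
        (I.pl i p).Pl {q | q ∈ I.Om i p ∧ (Sat q φ ∧ ¬ Sat q ψ)} <
          (I.pl i p).Pl {q | q ∈ I.Om i p ∧ (Sat q φ ∧ Sat q ψ)}
  | p, .next φ => Sat (p.1, p.2 + 1) φ

def QUAL : Prop := ∀ i p, (I.pl i p).Qualitative

def CONS : Prop := ∀ i p, I.Om i p ⊆ I.poss i p

def NORM : Prop := ∀ i p, (⊥ : (I.pl i p).D) < ⊤

def REF : Prop :=
  ∀ i p, p ∈ I.Om i p ∧ ∀ A : Set I.Point, A ⊆ I.Om i p → p ∈ A → ⊥ < (I.pl i p).Pl A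

def SDP : Prop := ∀ i p, ∀ q ∈ I.poss i p, (I.pl i p).Same (I.pl i q)

def UNIF : Prop := ∀ i p, ∀ q ∈ I.Om i p, (I.pl i p).Same (I.pl i q)

def RANK : Prop := ∀ i p, (I.pl i p).IsRanking

def Synchronous : Prop := ∀ (i : Fin n) (p q : I.Point), q ∈ I.poss i p → p.2 = q.2

/-- Perfect recall, for synchronous systems. -/
def PerfectRecall : Prop :=
  ∀ (i : Fin n) (r r' : I.Run) (m : ℕ),
    (r', m + 1) ∈ I.poss i (r, m + 1) → (r', m) ∈ I.poss i (r, m)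

/-- Coherence: sets of runs that are implausible at time `m` remain so at time `m + 1`. -/
def Coherent : Prop :=
  ∀ (i : Fin n) (r : I.Run) (m : ℕ) (R : Set I.Run) (A A' : Set I.Point),
    A ⊆ I.Om i (r, m) → I.runsOf A = R ∩ I.runsOf (I.Om i (r, m)) →
    A' ⊆ I.Om i (r, m + 1) → I.runsOf A' = R ∩ I.runsOf (I.Om i (r, m + 1)) →
    (I.pl i (r, m)).Pl A = ⊥ → (I.pl i (r, m + 1)).Pl A' = ⊥

def PERSIST : Prop :=
  ∀ (i : Fin n) (r r' : I.Run) (m : ℕ), (r', m + 1) ∈ I.poss i (r, m + 1) →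
    ((I.pl i (r, m + 1)).Same (I.pl i (r', m + 1)) ↔ (I.pl i (r, m)).Same (I.pl i (r', m)))

/-- The plausibility space of agent `i` at `(r, m)` is the time `m` projection of the space `prior`
on runs, conditioned on the set of runs that the agent considers possible at `(r, m)`. -/
def IsTimeProjection (i : Fin n) (r : I.Run) (m : ℕ) (prior : PlausibilitySpace I.Run) : Prop :=
  I.Om i (r, m) = {q | q ∈ I.poss i (r, m) ∧ q.2 = m ∧ q.1 ∈ prior.carrier} ∧
  ∀ A B : Set I.Point, A ⊆ I.Om i (r, m) → B ⊆ I.Om i (r, m) →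
    ((I.pl i (r, m)).Pl A ≤ (I.pl i (r, m)).Pl B ↔
      (prior.proj (I.runsOf (I.poss i (r, m)))).Pl (I.runsOf A) ≤
        (prior.proj (I.runsOf (I.poss i (r, m)))).Pl (I.runsOf B))

/-- The plausibility assignments are obtained by conditioning from priors on runs, one for each run
and agent. -/
def PRIOR : Prop :=
  I.Synchronous ∧ ∀ (i : Fin n) (r : I.Run), ∃ prior : PlausibilitySpace I.Run,
    ∀ m : ℕ, I.IsTimeProjection i r m prior

end InterpretedSystem

/-- Names of the conditions that may be imposed in addition. -/
inductive Condition
  | QUAL | NORM | REF | SDP | UNIF | RANK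

/-- The system satisfies the named condition. -/
def InterpretedSystem.Holds {n : ℕ} {Φ : Type v} (I : InterpretedSystem.{u, v} n Φ) :
    Condition → Prop
  | .QUAL => I.QUAL
  | .NORM => I.NORM
  | .REF => I.REF
  | .SDP => I.SDP
  | .UNIF => I.UNIF
  | .RANK => I.RANK

/-!
A run of the tagged system is a run of `I` together with a lifetime `m ≤ ∞`, which the agents learn
when it ends.  The prior at a run over `r` combines lexicographically, shorter lifetimes first,
copies of the spaces at the points `(s, m)` of `I`, each on the runs of lifetime `m`, where `s`
ranges over the runs whose space at time `0` is that of `r`.  At time `k` a run that is still alive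
can be distinguished from all runs of lifetime less than `k`, so the first component that survives
conditioning is the space at some `(s, k)` with `(s, k)` indistinguishable from `(r, k)`, and by
PERSIST this is the space at `(r, k)`.  Coherence ensures that the later components do not revive
sets that are implausible in the first.  So the immortal run over `r` satisfies the same temporally
linear formulas as `r`.  Under REF a point mass at each immortal run is added at the end, which
makes that run plausible.
-/

namespace PlausibilitySpace

variable {W V : Type u}

/-- The plausibility of the part of `A` that lies in the carrier; unlike `Pl`, it is meaningful for
every set. -/
def val (S : PlausibilitySpace W) (A : Set W) : S.D := S.Pl (A ∩ S.carrier)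

section val

variable (S : PlausibilitySpace W) {A B : Set W}

theorem val_of_subset (h : A ⊆ S.carrier) : S.val A = S.Pl A := by
  rw [val, Set.inter_eq_left.2 h]

theorem val_mono (h : A ⊆ B) : S.val A ≤ S.val B :=
  S.mono _ _ (Set.inter_subset_inter_left _ h) Set.inter_subset_right

theorem val_empty : S.val ∅ = ⊥ := by
  rw [val, Set.empty_inter, S.Pl_empty]

theorem val_univ : S.val Set.univ = ⊤ := by
  rw [val, Set.univ_inter, S.Pl_carrier]

theorem val_congr (h : ∀ x ∈ S.carrier, x ∈ A ↔ x ∈ B) : S.val A = S.val B :=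
  congrArg S.Pl (Set.ext fun x => and_congr_left (h x))

theorem val_carrier : S.val S.carrier = ⊤ :=
  (S.val_congr fun _ hx => iff_of_true hx trivial).trans S.val_univ

theorem val_eq_bot_of_subset (h : A ⊆ B) (hB : S.val B = ⊥) : S.val A = ⊥ :=
  le_bot_iff.1 (hB ▸ S.val_mono h)

theorem val_eq_bot_iff_le_val_empty : S.val A = ⊥ ↔ S.val A ≤ S.val ∅ := by
  rw [S.val_empty, le_bot_iff]

theorem Pl_sep_carrier (P : W → Prop) : S.Pl {x | x ∈ S.carrier ∧ P x} = S.val {x | P x} :=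
  congrArg S.Pl (Set.inter_comm S.carrier {x | P x})

theorem mem_carrier_of_val_singleton_ne_bot {x : W} (h : S.val {x} ≠ ⊥) : x ∈ S.carrier := by
  by_contra hx
  refine h ((S.val_congr fun y hy => ?_).trans S.val_empty)
  exact iff_of_false (fun hyx => hx (hyx ▸ hy)) (Set.notMem_empty y)

end val

theorem Same.refl (S : PlausibilitySpace W) : S.Same S := ⟨rfl, fun _ _ _ _ => Iff.rfl⟩

theorem Same.symm {S T : PlausibilitySpace W} (h : S.Same T) : T.Same S :=
  ⟨h.1.symm, fun A B hA hB => (h.2 A B (h.1 ▸ hA) (h.1 ▸ hB)).symm⟩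

theorem Same.trans {S T U : PlausibilitySpace W} (h : S.Same T) (h' : T.Same U) : S.Same U :=
  ⟨h.1.trans h'.1, fun A B hA hB =>
    (h.2 A B hA hB).trans (h'.2 A B (h.1 ▸ hA) (h.1 ▸ hB))⟩

theorem Same.val_le_iff {S T : PlausibilitySpace W} (h : S.Same T) (A B : Set W) :
    S.val A ≤ S.val B ↔ T.val A ≤ T.val B := by
  unfold val
  rw [← h.1]
  exact h.2 _ _ Set.inter_subset_right Set.inter_subset_right

theorem Same.val_eq_bot_iff {S T : PlausibilitySpace W} (h : S.Same T) (A : Set W) :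
    S.val A = ⊥ ↔ T.val A = ⊥ := by
  simp only [val_eq_bot_iff_le_val_empty, h.val_le_iff]

theorem qualitative_iff_val (S : PlausibilitySpace W) :
    S.Qualitative ↔
      (∀ A B C : Set W, Disjoint A B → Disjoint A C → Disjoint B C →
        S.val C < S.val (A ∪ B) → S.val B < S.val (A ∪ C) → S.val (B ∪ C) < S.val A) ∧
      (∀ A B : Set W, S.val A = ⊥ → S.val B = ⊥ → S.val (A ∪ B) = ⊥) := by
  constructor
  · rintro ⟨hA2, hA3⟩
    simp only [val, Set.union_inter_distrib_right]
    have restrict {A B : Set W} (h : Disjoint A B) : Disjoint (A ∩ S.carrier) (B ∩ S.carrier) :=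
      h.mono Set.inter_subset_left Set.inter_subset_left
    exact ⟨fun A B C hAB hAC hBC => hA2 _ _ _ Set.inter_subset_right Set.inter_subset_right
        Set.inter_subset_right (restrict hAB) (restrict hAC) (restrict hBC),
      fun A B => hA3 _ _ Set.inter_subset_right Set.inter_subset_right⟩
  · rintro ⟨hA2, hA3⟩
    refine ⟨fun A B C hA hB hC hAB hAC hBC => ?_, fun A B hA hB => ?_⟩
    · have h := hA2 A B C hAB hAC hBC
      rwa [S.val_of_subset hA, S.val_of_subset hB, S.val_of_subset hC,
        S.val_of_subset (Set.union_subset hA hB), S.val_of_subset (Set.union_subset hA hC),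
        S.val_of_subset (Set.union_subset hB hC)] at h
    · have h := hA3 A B
      rwa [S.val_of_subset hA, S.val_of_subset hB, S.val_of_subset (Set.union_subset hA hB)] at h

theorem isRanking_iff_val (S : PlausibilitySpace W) :
    S.IsRanking ↔ ∀ A B : Set W, (S.val A ≤ S.val B ∨ S.val B ≤ S.val A) ∧
      (S.val (A ∪ B) ≤ S.val A ∨ S.val (A ∪ B) ≤ S.val B) := by
  constructor
  · intro h A B
    simp only [val, Set.union_inter_distrib_right]
    obtain ⟨htotal, hmem, -⟩ := h (A ∩ S.carrier) (B ∩ S.carrier) Set.inter_subset_right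
      Set.inter_subset_right
    exact ⟨htotal, hmem.imp le_of_eq le_of_eq⟩
  · intro h A B hA hB
    have hl := S.val_mono (Set.subset_union_left : A ⊆ A ∪ B)
    have hr := S.val_mono (Set.subset_union_right : B ⊆ A ∪ B)
    rw [← S.val_of_subset hA, ← S.val_of_subset hB, ← S.val_of_subset (Set.union_subset hA hB)]
    refine ⟨(h A B).1, (h A B).2.imp hl.antisymm' hr.antisymm', ?_⟩
    rintro x (rfl | rfl)
    exacts [hl, hr]

section transfer

variable {S : PlausibilitySpace W} {T : PlausibilitySpace V} {g : Set V → Set W}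

theorem val_eq_bot_iff_of_le_iff (hempty : g ∅ = ∅)
    (hle : ∀ A B, T.val A ≤ T.val B ↔ S.val (g A) ≤ S.val (g B)) (A : Set V) :
    T.val A = ⊥ ↔ S.val (g A) = ⊥ := by
  rw [val_eq_bot_iff_le_val_empty, val_eq_bot_iff_le_val_empty, hle, hempty]

theorem Qualitative.of_le_iff (hS : S.Qualitative) (hempty : g ∅ = ∅)
    (hunion : ∀ A B, g (A ∪ B) = g A ∪ g B)
    (hdisjoint : ∀ A B, Disjoint A B → Disjoint (g A) (g B))
    (hle : ∀ A B, T.val A ≤ T.val B ↔ S.val (g A) ≤ S.val (g B)) : T.Qualitative := by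
  rw [qualitative_iff_val] at hS ⊢
  simp only [lt_iff_le_not_ge, hle, val_eq_bot_iff_of_le_iff hempty hle, hunion] at hS ⊢
  exact ⟨fun A B C hAB hAC hBC =>
    hS.1 _ _ _ (hdisjoint _ _ hAB) (hdisjoint _ _ hAC) (hdisjoint _ _ hBC), fun A B => hS.2 _ _⟩

theorem IsRanking.of_le_iff (hS : S.IsRanking) (hunion : ∀ A B, g (A ∪ B) = g A ∪ g B)
    (hle : ∀ A B, T.val A ≤ T.val B ↔ S.val (g A) ≤ S.val (g B)) : T.IsRanking := by
  rw [isRanking_iff_val] at hS ⊢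
  simp only [hle, hunion]
  exact fun A B => hS _ _

end transfer

theorem proj_val_le_iff (S : PlausibilitySpace W) (E A B : Set W) :
    (S.proj E).val A ≤ (S.proj E).val B ↔ S.val (A ∩ E) ≤ S.val (B ∩ E) := by
  have restrict (A : Set W) : A ∩ (S.carrier ∩ E) ∩ (S.carrier ∩ E) = A ∩ E ∩ S.carrier := by
    ext x
    simp only [Set.mem_inter_iff]
    tauto
  change S.Pl (A ∩ (S.carrier ∩ E) ∩ (S.carrier ∩ E)) ≤
    S.Pl (B ∩ (S.carrier ∩ E) ∩ (S.carrier ∩ E)) ↔ _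
  rw [restrict, restrict]
  rfl

theorem Qualitative.proj {S : PlausibilitySpace W} (h : S.Qualitative) (E : Set W) :
    (S.proj E).Qualitative :=
  h.of_le_iff (g := (· ∩ E)) (Set.empty_inter _)
    (fun A B => Set.union_inter_distrib_right A B E)
    (fun _ _ hd => hd.mono Set.inter_subset_left Set.inter_subset_left) (S.proj_val_le_iff E)

theorem IsRanking.proj {S : PlausibilitySpace W} (h : S.IsRanking) (E : Set W) :
    (S.proj E).IsRanking :=
  h.of_le_iff (g := (· ∩ E)) (fun A B => Set.union_inter_distrib_right A B E)
    (S.proj_val_le_iff E)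

/-- The push-forward of a plausibility space along a function: the plausibility of a set is that of
its preimage. -/
def map (h : W → V) (S : PlausibilitySpace W) : PlausibilitySpace V where
  carrier := h '' S.carrier
  D := S.D
  Pl := fun A => S.val (h ⁻¹' A)
  Pl_empty := S.val_empty
  Pl_carrier := by
    rw [← S.val_carrier]
    exact S.val_congr fun x hx => iff_of_true ⟨x, hx, rfl⟩ hx
  mono := fun _ _ hAB _ => S.val_mono (Set.preimage_mono hAB)

section map

variable (h : W → V) {S : PlausibilitySpace W}

theorem map_val (S : PlausibilitySpace W) (A : Set V) : (S.map h).val A = S.val (h ⁻¹' A) :=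
  S.val_congr fun x hx => and_iff_left ⟨x, hx, rfl⟩

theorem map_val_le_iff (S : PlausibilitySpace W) (A B : Set V) :
    (S.map h).val A ≤ (S.map h).val B ↔ S.val (h ⁻¹' A) ≤ S.val (h ⁻¹' B) := by
  rw [map_val, map_val]
  rfl

theorem map_val_eq_bot_iff (S : PlausibilitySpace W) (A : Set V) :
    (S.map h).val A = ⊥ ↔ S.val (h ⁻¹' A) = ⊥ :=
  val_eq_bot_iff_of_le_iff (g := (h ⁻¹' ·)) rfl (map_val_le_iff h S) A

theorem Same.map {T : PlausibilitySpace W} (hST : S.Same T) : (S.map h).Same (T.map h) :=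
  ⟨congrArg (h '' ·) hST.1, fun A B _ _ => hST.val_le_iff (h ⁻¹' A) (h ⁻¹' B)⟩

theorem Qualitative.map (hS : S.Qualitative) : (S.map h).Qualitative :=
  hS.of_le_iff (g := (h ⁻¹' ·)) rfl (fun _ _ => rfl) (fun _ _ hd => hd.preimage h)
    (map_val_le_iff h S)

theorem IsRanking.map (hS : S.IsRanking) : (S.map h).IsRanking :=
  hS.of_le_iff (g := (h ⁻¹' ·)) (fun _ _ => rfl) (map_val_le_iff h S)

end map

section ofMonotone

variable {P : Type u} [PartialOrder P]

/-- The plausibility space with carrier `C` whose values are those of a monotone function `F` on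
sets that does not depend on points outside `C`.  The domain is the interval of `P` between the
values of the empty set and of the whole space. -/
def ofMonotone (C : Set W) (F : Set W → P) (hF : Monotone F) (hC : ∀ A, F (A ∩ C) = F A) :
    PlausibilitySpace W where
  carrier := C
  D := Set.Icc (F ∅) (F Set.univ)
  bounded :=
    { top := ⟨F Set.univ, hF (Set.empty_subset _), le_rfl⟩
      le_top := fun a => a.2.2
      bot := ⟨F ∅, le_rfl, hF (Set.empty_subset _)⟩
      bot_le := fun a => a.2.1 }
  Pl := fun A => ⟨F A, hF (Set.empty_subset _), hF (Set.subset_univ _)⟩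
  Pl_empty := rfl
  Pl_carrier := Subtype.ext (Set.univ_inter C ▸ hC Set.univ)
  mono := fun _ _ h _ => hF h

theorem ofMonotone_val_le_iff {C : Set W} {F : Set W → P} {hF : Monotone F}
    {hC : ∀ A, F (A ∩ C) = F A} (A B : Set W) :
    (ofMonotone C F hF hC).val A ≤ (ofMonotone C F hF hC).val B ↔ F A ≤ F B := by
  rw [← hC A, ← hC B]
  rfl

end ofMonotone

/-- The plausibility space concentrated on one point. -/
def dirac (x : W) : PlausibilitySpace W :=
  ofMonotone {x} (· ∩ {x}) (fun _ _ h => Set.inter_subset_inter_left _ h)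
    (fun A => inf_right_idem A {x})

theorem dirac_val_le_iff (x : W) (A B : Set W) :
    (dirac x).val A ≤ (dirac x).val B ↔ (x ∈ A → x ∈ B) := by
  refine (ofMonotone_val_le_iff A B).trans ⟨fun h hx => (h ⟨hx, rfl⟩).1, ?_⟩
  rintro h _ ⟨hx, rfl⟩
  exact ⟨h hx, rfl⟩

theorem dirac_val_eq_bot_iff (x : W) (A : Set W) : (dirac x).val A = ⊥ ↔ x ∉ A := by
  rw [val_eq_bot_iff_le_val_empty, dirac_val_le_iff]
  rfl

theorem dirac_qualitative (x : W) : (dirac x).Qualitative := by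
  rw [qualitative_iff_val]
  simp only [lt_iff_le_not_ge, dirac_val_le_iff, dirac_val_eq_bot_iff, Set.mem_union,
    Set.disjoint_left]
  refine ⟨fun A B C hAB hAC hBC => ?_, fun A B => by tauto⟩
  have hAB' := @hAB x
  have hAC' := @hAC x
  have hBC' := @hBC x
  tauto

theorem dirac_isRanking (x : W) : (dirac x).IsRanking := by
  rw [isRanking_iff_val]
  simp only [dirac_val_le_iff, Set.mem_union]
  intro A B
  tauto

section lexSum

theorem toLex_le_toLex_iff_of_eq_below {ι : Type*} {β : ι → Type*} [LinearOrder ι]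
    [∀ i, PartialOrder (β i)] {a b : ∀ i, β i} {j : ι} (hlt : ∀ i < j, a i = b i)
    (heq : a j = b j → a = b) : toLex a ≤ toLex b ↔ a j ≤ b j := by
  constructor
  · intro h
    rcases h.eq_or_lt with h | ⟨i, hi, hai⟩
    · exact (congrFun (toLex_inj.1 h) j).le
    · rcases lt_trichotomy i j with hij | rfl | hij
      · exact absurd (hlt i hij) hai.ne
      · exact hai.le
      · exact (hi j hij).le
  · intro h
    rcases h.eq_or_lt with h | h
    · exact (congrArg toLex (heq h)).le
    · exact le_of_lt ⟨j, hlt, h⟩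

variable {ι : Type u} [LinearOrder ι] {S : ι → PlausibilitySpace W} {A B U : Set W}

open Classical in
variable (S) in
/-- The value of `A` at the first index at which `A` is plausible, as a family that is `⊥` at all
other indices.  Later values have to be discarded: a comparison that used them to break ties would
respect neither A2 nor rankings. -/
noncomputable def leadingVal (A : Set W) : Lex (∀ j, (S j).D) :=
  toLex fun j => if ∀ i < j, (S i).val A = ⊥ then (S j).val A else ⊥

theorem leadingVal_le_iff {j : ι} (hA : ∀ i < j, (S i).val A = ⊥) (hB : ∀ i < j, (S i).val B = ⊥)
    (hne : (S j).val A ≠ ⊥ ∨ (S j).val B ≠ ⊥) :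
    leadingVal S A ≤ leadingVal S B ↔ (S j).val A ≤ (S j).val B := by
  refine (toLex_le_toLex_iff_of_eq_below (j := j) (fun i hi => ?_)
    fun heq => funext fun i => ?_).trans ?_
  · simp only [hA i hi, hB i hi, ite_self]
  · simp only [if_pos hA, if_pos hB] at heq
    have hAj : (S j).val A ≠ ⊥ := hne.elim id fun h => heq ▸ h
    rcases lt_trichotomy i j with hij | rfl | hij
    · simp only [hA i hij, hB i hij, ite_self]
    · simp only [if_pos hA, if_pos hB, heq]
    · rw [if_neg fun h => hAj (h j hij), if_neg fun h => hAj (heq.trans (h j hij))]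
  · rw [if_pos hA, if_pos hB]

theorem leadingVal_inter_iUnion_carrier (A : Set W) :
    leadingVal S (A ∩ ⋃ j, (S j).carrier) = leadingVal S A := by
  have restrict (j : ι) : (S j).val (A ∩ ⋃ j, (S j).carrier) = (S j).val A :=
    (S j).val_congr fun x hx => and_iff_left (Set.mem_iUnion.2 ⟨j, hx⟩)
  classical
  exact congrArg toLex (funext fun j => if_congr (by simp only [restrict]) (restrict j) rfl)

variable [WellFoundedLT ι]

theorem exists_first_plausible (h : ¬∀ j, (S j).val A = ⊥) :
    ∃ j, (S j).val A ≠ ⊥ ∧ ∀ i < j, (S i).val A = ⊥ := by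
  push Not at h
  obtain ⟨j, hj⟩ := exists_minimal_of_wellFoundedLT (fun j => (S j).val A ≠ ⊥) h
  exact ⟨j, hj.prop, fun i hi => not_not.1 (hj.not_prop_of_lt hi)⟩

theorem leadingVal_le_of_forall_eq_bot (hA : ∀ j, (S j).val A = ⊥) (B : Set W) :
    leadingVal S A ≤ leadingVal S B :=
  Pi.toLex_monotone fun j => by simp only [hA, ite_self, bot_le]

theorem leadingVal_monotone : Monotone (leadingVal S) := by
  intro A B hAB
  by_cases hB : ∀ j, (S j).val B = ⊥
  · exact leadingVal_le_of_forall_eq_bot (fun j => (S j).val_eq_bot_of_subset hAB (hB j)) B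
  · obtain ⟨j, hj, hlt⟩ := exists_first_plausible hB
    exact (leadingVal_le_iff (fun i hi => (S i).val_eq_bot_of_subset hAB (hlt i hi)) hlt
      (Or.inr hj)).2 ((S j).val_mono hAB)

variable (S) in
/-- The lexicographic combination of plausibility spaces: sets are compared at the first index at
which one of them is plausible. -/
noncomputable def lexSum : PlausibilitySpace W :=
  ofMonotone (⋃ j, (S j).carrier) (leadingVal S) leadingVal_monotone
    leadingVal_inter_iUnion_carrier

theorem lexSum_val_eq_bot_iff : (lexSum S).val A = ⊥ ↔ ∀ j, (S j).val A = ⊥ := by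
  rw [val_eq_bot_iff_le_val_empty]
  refine (ofMonotone_val_le_iff A ∅).trans ⟨fun h => ?_,
    fun h => leadingVal_le_of_forall_eq_bot h ∅⟩
  by_contra hA
  obtain ⟨j, hj, hlt⟩ := exists_first_plausible hA
  rw [leadingVal_le_iff hlt (fun i _ => (S i).val_empty) (Or.inl hj), (S j).val_empty,
    le_bot_iff] at h
  exact hj h

theorem lexSum_val_le_iff {j : ι} (hA : ∀ i < j, (S i).val A = ⊥) (hB : ∀ i < j, (S i).val B = ⊥)
    (hne : (S j).val A ≠ ⊥ ∨ (S j).val B ≠ ⊥) :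
    (lexSum S).val A ≤ (lexSum S).val B ↔ (S j).val A ≤ (S j).val B :=
  (ofMonotone_val_le_iff A B).trans (leadingVal_le_iff hA hB hne)

theorem lexSum_val_le_iff_of_eq_bot {j : ι} (hA : ∀ i < j, (S i).val A = ⊥)
    (hB : ∀ i < j, (S i).val B = ⊥) (hbot : (S j).val A = ⊥ → ∀ i, (S i).val A = ⊥) :
    (lexSum S).val A ≤ (lexSum S).val B ↔ (S j).val A ≤ (S j).val B := by
  by_cases h : (S j).val A = ⊥
  · rw [h, lexSum_val_eq_bot_iff.2 (hbot h)]
    exact iff_of_true bot_le bot_le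
  · exact lexSum_val_le_iff hA hB (Or.inl h)

theorem exists_lexSum_val_le_iff (hU : (lexSum S).val U ≠ ⊥) :
    ∃ j, (S j).val U ≠ ⊥ ∧ ∀ A ⊆ U, ∀ B ⊆ U, ((S j).val A ≠ ⊥ ∨ (S j).val B ≠ ⊥) →
      ((lexSum S).val A ≤ (lexSum S).val B ↔ (S j).val A ≤ (S j).val B) := by
  obtain ⟨j, hj, hlt⟩ := exists_first_plausible (mt lexSum_val_eq_bot_iff.2 hU)
  exact ⟨j, hj, fun A hA B hB => lexSum_val_le_iff
    (fun i hi => (S i).val_eq_bot_of_subset hA (hlt i hi))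
    fun i hi => (S i).val_eq_bot_of_subset hB (hlt i hi)⟩

theorem Qualitative.lexSum (h : ∀ j, (S j).Qualitative) : (lexSum S).Qualitative := by
  simp only [qualitative_iff_val] at h ⊢
  refine ⟨fun A B C hAB hAC hBC hC hB => ?_, fun A B hA hB => ?_⟩
  · have hU : (PlausibilitySpace.lexSum S).val (A ∪ B ∪ C) ≠ ⊥ := fun hU =>
      not_lt_bot ((val_eq_bot_of_subset _ Set.subset_union_left hU) ▸ hC)
    obtain ⟨j, hj, hle⟩ := exists_lexSum_val_le_iff hU
    have hlt (X Y : Set W) (hXY : X ∪ Y = A ∪ B ∪ C) :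
        (PlausibilitySpace.lexSum S).val X < (PlausibilitySpace.lexSum S).val Y ↔
          (S j).val X < (S j).val Y := by
      have hne : (S j).val X ≠ ⊥ ∨ (S j).val Y ≠ ⊥ := by
        by_contra! hbot
        exact hj (hXY ▸ (h j).2 X Y hbot.1 hbot.2)
      have hX : X ⊆ A ∪ B ∪ C := hXY ▸ Set.subset_union_left
      have hY : Y ⊆ A ∪ B ∪ C := hXY ▸ Set.subset_union_right
      rw [lt_iff_le_not_ge, lt_iff_le_not_ge, hle X hX Y hY hne, hle Y hY X hX hne.symm]
    rw [hlt _ _ (by ac_rfl)] at hC hB ⊢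
    exact (h j).1 A B C hAB hAC hBC hC hB
  · rw [lexSum_val_eq_bot_iff] at *
    exact fun j => (h j).2 A B (hA j) (hB j)

theorem IsRanking.lexSum (h : ∀ j, (S j).IsRanking) : (lexSum S).IsRanking := by
  simp only [isRanking_iff_val] at h ⊢
  intro A B
  have hA : A ⊆ A ∪ B := Set.subset_union_left
  have hB : B ⊆ A ∪ B := Set.subset_union_right
  by_cases hU : (PlausibilitySpace.lexSum S).val (A ∪ B) = ⊥
  · rw [hU, val_eq_bot_of_subset _ hA hU]
    exact ⟨Or.inl bot_le, Or.inl bot_le⟩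
  · obtain ⟨j, hj, hle⟩ := exists_lexSum_val_le_iff hU
    have hne : (S j).val A ≠ ⊥ ∨ (S j).val B ≠ ⊥ := by
      by_contra! hbot
      exact hj (le_bot_iff.1 ((h j A B).2.elim (·.trans_eq hbot.1) (·.trans_eq hbot.2)))
    rw [hle A hA B hB hne, hle B hB A hA hne.symm, hle _ subset_rfl A hA (Or.inl hj),
      hle _ subset_rfl B hB (Or.inl hj)]
    exact h j A B

end lexSum

end PlausibilitySpace

namespace InterpretedSystem

open PlausibilitySpace

variable {n : ℕ} {Φ : Type v} {I : InterpretedSystem.{u, v} n Φ}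

variable (I) in
/-- The plausibility space of agent `i` at the point `(r, k)`, transported from points to runs. -/
def runSpace (i : Fin n) (r : I.Run) (k : ℕ) : PlausibilitySpace I.Run :=
  (I.pl i (r, k)).map Prod.fst

theorem mem_poss_of_mem_runSpace_carrier (hsync : I.Synchronous) (hcons : I.CONS) {i : Fin n}
    {r s : I.Run} {k : ℕ} (hs : s ∈ (I.runSpace i r k).carrier) : (s, k) ∈ I.poss i (r, k) := by
  obtain ⟨⟨s, l⟩, hq, rfl⟩ := hs
  obtain rfl : k = l := hsync i _ _ (hcons i _ hq)
  exact hcons i _ hq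

theorem Coherent.runSpace_val_eq_bot (hcoh : I.Coherent) {i : Fin n} {r : I.Run} {X : Set I.Run}
    {k l : ℕ} (hkl : k ≤ l) (h : (I.runSpace i r k).val X = ⊥) :
    (I.runSpace i r l).val X = ⊥ := by
  rw [runSpace, map_val_eq_bot_iff] at h ⊢
  induction l, hkl using Nat.le_induction with
  | base => exact h
  | succ l _ ih =>
    have runsOf_inter (O : Set I.Point) :
        I.runsOf (Prod.fst ⁻¹' X ∩ O) = X ∩ I.runsOf O := Set.ext fun s =>
      ⟨fun ⟨m, hX, hm⟩ => ⟨hX, m, hm⟩, fun ⟨hX, m, hm⟩ => ⟨m, hX, hm⟩⟩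
    exact hcoh i r l X _ _ Set.inter_subset_right (runsOf_inter _) Set.inter_subset_right
      (runsOf_inter _) ih

theorem PerfectRecall.mem_poss_of_le (hrec : I.PerfectRecall) {i : Fin n} {r s : I.Run}
    {k l : ℕ} (hkl : k ≤ l) (h : (s, l) ∈ I.poss i (r, l)) : (s, k) ∈ I.poss i (r, k) := by
  induction l, hkl using Nat.le_induction with
  | base => exact h
  | succ l _ ih => exact ih (hrec i r s l h)

theorem PERSIST.same_iff_same_zero (hpers : I.PERSIST) (hrec : I.PerfectRecall) {i : Fin n}
    {r s : I.Run} {k : ℕ} (h : (s, k) ∈ I.poss i (r, k)) :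
    (I.pl i (r, k)).Same (I.pl i (s, k)) ↔ (I.pl i (r, 0)).Same (I.pl i (s, 0)) := by
  induction k with
  | zero => rfl
  | succ k ih => exact (hpers i r s k h).trans (ih (hrec i r s k h))

theorem PRIOR.cons (h : I.PRIOR) : I.CONS := by
  rintro i ⟨r, m⟩ q hq
  obtain ⟨prior, hprior⟩ := h.2 i r
  rw [(hprior m).1] at hq
  exact hq.1

theorem norm_iff_val : I.NORM ↔ ∀ i p, (I.pl i p).val Set.univ ≠ ⊥ := by
  simp only [NORM, val_univ, bot_lt_iff_ne_bot]

theorem ref_iff_val : I.REF ↔ ∀ i p, ∀ A : Set I.Point, p ∈ A → (I.pl i p).val A ≠ ⊥ := by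
  refine forall₂_congr fun i p => ⟨fun ⟨hp, h⟩ A hA => ?_, fun h => ⟨?_, fun A hAO hA => ?_⟩⟩
  · exact (h _ Set.inter_subset_right ⟨hA, hp⟩).ne'
  · exact mem_carrier_of_val_singleton_ne_bot _ (h {p} rfl)
  · rw [bot_lt_iff_ne_bot, ← val_of_subset _ hAO]
    exact h A hA

theorem REF.runSpace_val_ne_bot (h : I.REF) (i : Fin n) {r : I.Run} (k : ℕ) {X : Set I.Run}
    (hr : r ∈ X) : (I.runSpace i r k).val X ≠ ⊥ := by
  rw [runSpace, Ne, map_val_eq_bot_iff]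
  exact ref_iff_val.1 h i (r, k) _ hr

theorem runsOf_eq_preimage {A : Set I.Point} {m : ℕ} (hA : ∀ q ∈ A, q.2 = m) :
    I.runsOf A = (·, m) ⁻¹' A :=
  Set.ext fun _ => ⟨fun ⟨_, hl⟩ => hA _ hl ▸ hl, fun hs => ⟨m, hs⟩⟩

theorem isTimeProjection_of_pl_eq (hsync : I.Synchronous) {i : Fin n} {r : I.Run} {m : ℕ}
    {prior : PlausibilitySpace I.Run}
    (h : I.pl i (r, m) = (prior.proj (I.runsOf (I.poss i (r, m)))).map (·, m)) :
    I.IsTimeProjection i r m prior := by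
  have runsOf_poss : I.runsOf (I.poss i (r, m)) = (·, m) ⁻¹' I.poss i (r, m) :=
    runsOf_eq_preimage fun q hq => (hsync i _ q hq).symm
  rw [IsTimeProjection, Om, h, runsOf_poss]
  refine ⟨Set.ext fun q => ⟨?_, ?_⟩, fun A B hA hB => ?_⟩
  · rintro ⟨s, ⟨hs, hsm⟩, rfl⟩
    exact ⟨hsm, rfl, hs⟩
  · rintro ⟨hq, rfl, hs⟩
    exact ⟨q.1, ⟨hs, hq⟩, rfl⟩
  · have runsOf_eq {A : Set I.Point}
        (hA : A ⊆ ((prior.proj ((·, m) ⁻¹' I.poss i (r, m))).map (·, m)).carrier) :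
        I.runsOf A = (·, m) ⁻¹' A ∧
          (·, m) ⁻¹' A ⊆ (prior.proj ((·, m) ⁻¹' I.poss i (r, m))).carrier := by
      refine ⟨runsOf_eq_preimage fun q hq => ?_, fun s hs => ?_⟩
      · obtain ⟨_, -, rfl⟩ := hA hq
        rfl
      · obtain ⟨_, hs', heq⟩ := hA hs
        obtain rfl := congrArg Prod.fst heq
        exact hs'
    rw [(runsOf_eq hA).1, (runsOf_eq hB).1, ← val_of_subset _ (runsOf_eq hA).2,
      ← val_of_subset _ (runsOf_eq hB).2]
    rfl

theorem sat_cond_iff (hsync : I.Synchronous) (hcons : I.CONS) (i : Fin n) (r : I.Run) (k : ℕ)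
    (φ ψ : Formula n Φ) :
    I.Sat (r, k) (.cond i φ ψ) ↔ (I.runSpace i r k).val {s | I.Sat (s, k) φ} = ⊥ ∨
      (I.runSpace i r k).val {s | I.Sat (s, k) φ ∧ ¬I.Sat (s, k) ψ} <
        (I.runSpace i r k).val {s | I.Sat (s, k) φ ∧ I.Sat (s, k) ψ} := by
  have Pl_eq (P : I.Point → Prop) :
      (I.pl i (r, k)).Pl {q | q ∈ I.Om i (r, k) ∧ P q} =
        (I.runSpace i r k).val {s | P (s, k)} := by
    refine (Pl_sep_carrier _ P).trans (Eq.trans ?_ (map_val _ _ _).symm)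
    refine val_congr _ fun ⟨s, l⟩ hq => ?_
    obtain rfl : k = l := hsync i _ _ (hcons i _ hq)
    rfl
  rw [Sat, Pl_eq (I.Sat · φ), Pl_eq fun q => I.Sat q φ ∧ ¬I.Sat q ψ,
    Pl_eq fun q => I.Sat q φ ∧ I.Sat q ψ]
  rfl

variable (I) in
/-- The run of the tagged system that belongs to a run `s` of `I` and a lifetime `m`.  The
environment records the current point of `I` and the lifetime, and the agents learn the lifetime
only when it ends. -/
noncomputable def taggedRun (s : I.Run) (m : ℕ∞) :
    ℕ → (I.Point × ℕ∞) × (∀ i, I.Loc i × ℕ∞) :=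
  fun k => (((s, k), m), fun i => (I.localState i (s, k), min m k))

variable (I) in
/-- The runs of the tagged system. -/
abbrev TaggedRun : Type u := ↥(Set.range fun x : I.Run × ℕ∞ => I.taggedRun x.1 x.2)

namespace TaggedRun

/-- The run `s` of `I` with lifetime `m`, as a run of the tagged system. -/
noncomputable def tag (s : I.Run) (m : ℕ∞) : I.TaggedRun := ⟨I.taggedRun s m, (s, m), rfl⟩

/-- The run of `I` that underlies a run of the tagged system. -/
def base (t : I.TaggedRun) : I.Run := (t.1 0).1.1.1

/-- The lifetime of a run of the tagged system. -/
def life (t : I.TaggedRun) : ℕ∞ := (t.1 0).1.2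

theorem coe_eq (t : I.TaggedRun) : t.1 = I.taggedRun t.base t.life := by
  obtain ⟨_, ⟨s, m⟩, rfl⟩ := t
  rfl

end TaggedRun

open TaggedRun

variable (I) in
/-- The runs of the tagged system that agent `i` cannot distinguish from `t` at time `k`. -/
def indist (i : Fin n) (t : I.TaggedRun) (k : ℕ) : Set I.TaggedRun :=
  {t' | (t'.base, k) ∈ I.poss i (t.base, k) ∧ min t'.life (k : ℕ∞) = min t.life k}

theorem indist_congr {i : Fin n} {t t' : I.TaggedRun} {k : ℕ} (h : t' ∈ I.indist i t k) :
    I.indist i t k = I.indist i t' k :=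
  Set.ext fun _ => and_congr ⟨fun h' => Eq.trans h' h.1.symm, fun h' => Eq.trans h' h.1⟩
    ⟨fun h' => h'.trans h.2.symm, fun h' => h'.trans h.2⟩

theorem mem_indist_iff_of_le_life {i : Fin n} {t t' : I.TaggedRun} {k : ℕ}
    (hk : (k : ℕ∞) ≤ t.life) :
    t' ∈ I.indist i t k ↔ (t'.base, k) ∈ I.poss i (t.base, k) ∧ (k : ℕ∞) ≤ t'.life := by
  rw [indist, Set.mem_ofPred_eq, min_eq_right hk, min_eq_right_iff]

variable (I) in
/-- The component of the priors of agent `i` that belongs to a lifetime `m` and a run `s`.  For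
finite `m` it is the plausibility space at the point `(s, m)`, carried by the runs of lifetime `m`;
for `m = ⊤` it is concentrated on the immortal copy of `s`. -/
noncomputable def component (i : Fin n) (m : ℕ∞) (s : I.Run) : PlausibilitySpace I.TaggedRun :=
  ENat.recTopCoe (C := fun _ => PlausibilitySpace I.TaggedRun) (dirac (tag s ⊤))
    (fun m => (I.runSpace i s m).map (tag · m)) m

theorem component_coe_val_eq_bot_iff (i : Fin n) (m : ℕ) (s : I.Run) (A : Set I.TaggedRun) :
    (I.component i m s).val A = ⊥ ↔ (I.runSpace i s m).val {s' | tag s' m ∈ A} = ⊥ :=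
  map_val_eq_bot_iff _ _ A

theorem component_top_val_eq_bot_iff (i : Fin n) (s : I.Run) (A : Set I.TaggedRun) :
    (I.component i ⊤ s).val A = ⊥ ↔ tag s ⊤ ∉ A :=
  dirac_val_eq_bot_iff _ A

theorem REF.component_val_ne_bot (h : I.REF) (i : Fin n) {t : I.TaggedRun}
    {A : Set I.TaggedRun} (ht : t ∈ A) : (I.component i t.life t.base).val A ≠ ⊥ := by
  obtain ⟨_, ⟨s, m⟩, rfl⟩ := t
  change (I.component i m s).val A ≠ ⊥
  induction m using ENat.recTopCoe with
  | top => exact fun hbot => (component_top_val_eq_bot_iff i s A).1 hbot ht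
  | coe m =>
    rw [Ne, component_coe_val_eq_bot_iff]
    exact h.runSpace_val_ne_bot i m ht

theorem mem_indist_iff_of_mem_component_carrier (hsync : I.Synchronous) (hrec : I.PerfectRecall)
    (hcons : I.CONS) {i : Fin n} {t t' : I.TaggedRun} {k : ℕ} (hk : (k : ℕ∞) ≤ t.life) {m : ℕ∞}
    {s : I.Run} (ht' : t' ∈ (I.component i m s).carrier) :
    t' ∈ I.indist i t k ↔ tag s m ∈ I.indist i t k := by
  induction m using ENat.recTopCoe with
  | top =>
    obtain rfl : t' = tag s ⊤ := ht'
    rfl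
  | coe m =>
    obtain ⟨s', hs', rfl⟩ := ht'
    rw [mem_indist_iff_of_le_life hk, mem_indist_iff_of_le_life hk]
    refine and_congr_left fun hkm => ?_
    have h : (s', k) ∈ I.poss i (s, k) := hrec.mem_poss_of_le (Nat.cast_le.1 hkm)
      (mem_poss_of_mem_runSpace_carrier hsync hcons hs')
    exact ⟨fun h' => Eq.trans (Eq.symm h) h', fun h' => Eq.trans h h'⟩

/-- A well-order of the runs, which orders the components of equal lifetime. -/
noncomputable instance : LinearOrder I.Run := IsWellOrder.linearOrder WellOrderingRel

instance : WellFoundedLT I.Run := WellOrderingRel.isWellOrder.toIsWellFounded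

variable (I) in
/-- The indices of the components of the prior of agent `i` at runs over `r`, ordered by lifetime
first.  The immortal components are needed for REF only, and would destroy the agreement with `I`
without it. -/
def indices (i : Fin n) (r : I.Run) : Set (ℕ∞ ×ₗ I.Run) :=
  {j | (I.pl i (r, 0)).Same (I.pl i ((ofLex j).2, 0)) ∧ ((ofLex j).1 = ⊤ → I.REF)}

theorem coe_mem_indices (i : Fin n) (m : ℕ) (r : I.Run) : toLex ((m : ℕ∞), r) ∈ I.indices i r :=
  ⟨.refl _, fun h => absurd h (ENat.natCast_ne_top m)⟩

variable (I) in
/-- The prior of agent `i` at the runs of the tagged system that lie over `r`. -/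
noncomputable def prior (i : Fin n) (r : I.Run) : PlausibilitySpace I.TaggedRun :=
  lexSum fun j : I.indices i r => I.component i (ofLex j.1).1 (ofLex j.1).2

theorem prior_congr {i : Fin n} {r s : I.Run} (h : (I.pl i (r, 0)).Same (I.pl i (s, 0))) :
    I.prior i r = I.prior i s := by
  have indices_eq : I.indices i r = I.indices i s :=
    Set.ext fun _ => and_congr_left fun _ => ⟨h.symm.trans, h.trans⟩
  exact congrArg (fun J : Set (ℕ∞ ×ₗ I.Run) =>
    lexSum fun j : J => I.component i (ofLex j.1).1 (ofLex j.1).2) indices_eq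

variable (I) in
/-- The tagged system: every run of `I` is provided with all possible lifetimes, and plausibilities
are obtained from `prior` by conditioning. -/
noncomputable abbrev tagged : InterpretedSystem.{u, v} n Φ where
  Env := I.Point × ℕ∞
  Loc := fun i => I.Loc i × ℕ∞
  runs := Set.range fun x : I.Run × ℕ∞ => I.taggedRun x.1 x.2
  val := fun g => I.val (g.1.1.1.1 g.1.1.2)
  pl := fun i p => ((I.prior i (base p.1)).proj (I.indist i p.1 p.2)).map (·, p.2)

theorem mem_tagged_poss_iff (i : Fin n) (t t' : I.TaggedRun) (k k' : ℕ) :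
    (t', k') ∈ I.tagged.poss i (t, k) ↔
      (t'.base, k') ∈ I.poss i (t.base, k) ∧ min t'.life (k' : ℕ∞) = min t.life k := by
  change (t'.1 k').2 i = (t.1 k).2 i ↔ _
  rw [t.coe_eq, t'.coe_eq]
  exact Prod.ext_iff

theorem mem_tagged_Om_iff (i : Fin n) (t : I.TaggedRun) (k : ℕ) (q : I.TaggedRun × ℕ) :
    q ∈ I.tagged.Om i (t, k) ↔
      q.1 ∈ (I.prior i t.base).carrier ∧ q.1 ∈ I.indist i t k ∧ q.2 = k := by
  constructor
  · rintro ⟨t', ⟨h, h'⟩, rfl⟩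
    exact ⟨h, h', rfl⟩
  · rintro ⟨h, h', rfl⟩
    exact ⟨q.1, ⟨h, h'⟩, rfl⟩

theorem tagged_val_le_iff (i : Fin n) (t : I.TaggedRun) (k : ℕ) (A B : Set (I.TaggedRun × ℕ)) :
    (I.tagged.pl i (t, k)).val A ≤ (I.tagged.pl i (t, k)).val B ↔
      (I.prior i t.base).val ((·, k) ⁻¹' A ∩ I.indist i t k) ≤
        (I.prior i t.base).val ((·, k) ⁻¹' B ∩ I.indist i t k) :=
  (map_val_le_iff _ _ A B).trans (proj_val_le_iff _ _ _ _)

theorem tagged_val_eq_bot_iff (i : Fin n) (t : I.TaggedRun) (k : ℕ)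
    (A : Set (I.TaggedRun × ℕ)) :
    (I.tagged.pl i (t, k)).val A = ⊥ ↔
      ∀ j : I.indices i t.base, (I.component i (ofLex j.1).1 (ofLex j.1).2).val
        ((·, k) ⁻¹' A ∩ I.indist i t k) = ⊥ :=
  (val_eq_bot_iff_of_le_iff (g := fun A => (·, k) ⁻¹' A ∩ I.indist i t k)
    (Set.empty_inter _) (tagged_val_le_iff i t k) A).trans lexSum_val_eq_bot_iff

theorem tagged_pl_congr {i : Fin n} {t t' : I.TaggedRun} {k : ℕ} (h : t' ∈ I.indist i t k)
    (h' : (I.pl i (t.base, 0)).Same (I.pl i (t'.base, 0))) :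
    I.tagged.pl i (t, k) = I.tagged.pl i (t', k) := by
  change ((I.prior i t.base).proj (I.indist i t k)).map _ =
    ((I.prior i t'.base).proj (I.indist i t' k)).map _
  rw [prior_congr h', indist_congr h]

theorem tagged_synchronous (hsync : I.Synchronous) : I.tagged.Synchronous :=
  fun i ((t : I.TaggedRun), k) ((t' : I.TaggedRun), k') h =>
    hsync i (t.base, k) (t'.base, k') ((mem_tagged_poss_iff i t t' k k').1 h).1

theorem tagged_perfectRecall (hrec : I.PerfectRecall) : I.tagged.PerfectRecall := by
  intro i (t : I.TaggedRun) (t' : I.TaggedRun) m h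
  rw [mem_tagged_poss_iff] at h ⊢
  have min_min_succ (x : ℕ∞) : min (min x ((m + 1 : ℕ) : ℕ∞)) m = min x m := by
    rw [min_assoc, min_eq_right (Nat.cast_le.2 m.le_succ)]
  exact ⟨hrec i _ _ m h.1, by rw [← min_min_succ, h.2, min_min_succ]⟩

theorem tagged_prior (hsync : I.Synchronous) : I.tagged.PRIOR := by
  refine ⟨tagged_synchronous hsync, fun i (t : I.TaggedRun) => ⟨I.prior i t.base, fun k =>
    isTimeProjection_of_pl_eq (tagged_synchronous hsync) ?_⟩⟩
  rw [runsOf_eq_preimage fun q hq => (tagged_synchronous hsync i _ q hq).symm,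
    (Set.ext fun t' => mem_tagged_poss_iff i t t' k k :
      (·, k) ⁻¹' I.tagged.poss i (t, k) = I.indist i t k)]

theorem tagged_qual (h : I.QUAL) : I.tagged.QUAL := by
  refine fun i p => ((Qualitative.lexSum ?_).proj _).map _
  rintro ⟨⟨m, s⟩, -⟩
  induction m using ENat.recTopCoe with
  | top => exact dirac_qualitative _
  | coe m => exact ((h i (s, m)).map _).map _

theorem tagged_rank (h : I.RANK) : I.tagged.RANK := by
  refine fun i p => ((IsRanking.lexSum ?_).proj _).map _
  rintro ⟨⟨m, s⟩, -⟩
  induction m using ENat.recTopCoe with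
  | top => exact dirac_isRanking _
  | coe m => exact ((h i (s, m)).map _).map _

theorem tagged_sdp (hsync : I.Synchronous) (hrec : I.PerfectRecall) (h : I.SDP) :
    I.tagged.SDP := by
  rintro i ⟨(t : I.TaggedRun), k⟩ ⟨(t' : I.TaggedRun), k'⟩ hq
  obtain rfl : k = k' := tagged_synchronous hsync i _ _ hq
  rw [mem_tagged_poss_iff] at hq
  rw [tagged_pl_congr hq (h i _ _ (hrec.mem_poss_of_le k.zero_le hq.1))]
  exact .refl _

theorem UNIF.same_of_mem_component_carrier (h : I.UNIF) (hsync : I.Synchronous)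
    (hrec : I.PerfectRecall) (hcons : I.CONS) (hpers : I.PERSIST) {i : Fin n} {m : ℕ∞}
    {s : I.Run} {t : I.TaggedRun} (ht : t ∈ (I.component i m s).carrier) :
    (I.pl i (s, 0)).Same (I.pl i (t.base, 0)) := by
  induction m using ENat.recTopCoe with
  | top =>
    obtain rfl : t = tag s ⊤ := ht
    exact .refl _
  | coe m =>
    obtain ⟨_, ⟨⟨s', l⟩, hO, rfl⟩, rfl⟩ := ht
    have hp := hcons i _ hO
    obtain rfl : m = l := hsync i _ _ hp
    exact (hpers.same_iff_same_zero hrec hp).1 (h i _ _ hO)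

theorem tagged_unif (hsync : I.Synchronous) (hrec : I.PerfectRecall) (hcons : I.CONS)
    (hpers : I.PERSIST) (h : I.UNIF) : I.tagged.UNIF := by
  rintro i ⟨(t : I.TaggedRun), k⟩ ⟨(t' : I.TaggedRun), k'⟩ hq
  obtain ⟨ht', hind, rfl⟩ := (mem_tagged_Om_iff i t k _).1 hq
  obtain ⟨j, hj⟩ := Set.mem_iUnion.1 ht'
  rw [tagged_pl_congr hind
    (j.2.1.trans (h.same_of_mem_component_carrier hsync hrec hcons hpers hj))]
  exact .refl _

theorem tagged_norm (hcoh : I.Coherent) (hsync : I.Synchronous) (hcons : I.CONS) (h : I.NORM) :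
    I.tagged.NORM := by
  rw [norm_iff_val]
  rintro i ⟨(t : I.TaggedRun), k⟩ hbot
  obtain ⟨l, hl⟩ : ∃ l : ℕ, (l : ℕ∞) = min t.life k :=
    ENat.ne_top_iff_exists.1 (ne_top_of_le_ne_top (ENat.natCast_ne_top k) (min_le_right _ _))
  have hlk : l ≤ k := Nat.cast_le.1 (hl.trans_le (min_le_right _ _))
  have hbot_l : (I.runSpace i t.base l).val {s | (s, k) ∈ I.poss i (t.base, k)} = ⊥ := by
    rw [← (component_coe_val_eq_bot_iff i l t.base _).1
      ((tagged_val_eq_bot_iff i t k _).1 hbot ⟨_, coe_mem_indices i l t.base⟩)]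
    congr 1
    ext s
    refine ⟨fun hs => ⟨trivial, hs, ?_⟩, fun hs => hs.2.1⟩
    exact (min_eq_left (Nat.cast_le.2 hlk)).trans hl
  refine norm_iff_val.1 h i (t.base, k) ((map_val_eq_bot_iff Prod.fst _ Set.univ).1 ?_)
  refine Eq.trans ?_ (hcoh.runSpace_val_eq_bot hlk hbot_l)
  exact val_congr _ fun s hs =>
    iff_of_true trivial (mem_poss_of_mem_runSpace_carrier hsync hcons hs)

theorem tagged_ref (h : I.REF) : I.tagged.REF := by
  rw [ref_iff_val]
  rintro i ⟨(t : I.TaggedRun), k⟩ A ht hbot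
  rw [tagged_val_eq_bot_iff] at hbot
  have ht' : t ∈ (·, k) ⁻¹' A ∩ I.indist i t k := ⟨ht, rfl, rfl⟩
  exact h.component_val_ne_bot i ht' (hbot ⟨toLex (t.life, t.base), .refl _, fun _ => h⟩)

theorem component_val_inter_indist (hsync : I.Synchronous) (hrec : I.PerfectRecall)
    (hcons : I.CONS) {i : Fin n} {t : I.TaggedRun} {k : ℕ} (hk : (k : ℕ∞) ≤ t.life) {m : ℕ∞}
    {s : I.Run} (h : tag s m ∈ I.indist i t k) (A : Set I.TaggedRun) :
    (I.component i m s).val (A ∩ I.indist i t k) = (I.component i m s).val A :=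
  val_congr _ fun _ ht' =>
    and_iff_left ((mem_indist_iff_of_mem_component_carrier hsync hrec hcons hk ht').2 h)

theorem component_val_inter_indist_eq_bot (hsync : I.Synchronous) (hrec : I.PerfectRecall)
    (hcons : I.CONS) {i : Fin n} {t : I.TaggedRun} {k : ℕ} (hk : (k : ℕ∞) ≤ t.life) {m : ℕ∞}
    {s : I.Run} (h : tag s m ∉ I.indist i t k) (A : Set I.TaggedRun) :
    (I.component i m s).val (A ∩ I.indist i t k) = ⊥ := by
  refine (val_congr _ fun t' ht' => iff_of_false (fun hA => h ?_) (Set.notMem_empty t')).trans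
    (val_empty _)
  exact (mem_indist_iff_of_mem_component_carrier hsync hrec hcons hk ht').1 hA.2

theorem component_val_eq_bot_of_runSpace_val_eq_bot (hcoh : I.Coherent) (hsync : I.Synchronous)
    (hrec : I.PerfectRecall) (hcons : I.CONS) (hpers : I.PERSIST) {i : Fin n} {t : I.TaggedRun}
    {k : ℕ} (hk : (k : ℕ∞) ≤ t.life) {X : Set I.Run} (hX : (I.runSpace i t.base k).val X = ⊥)
    {j : ℕ∞ ×ₗ I.Run} (hj : j ∈ I.indices i t.base) :
    (I.component i (ofLex j).1 (ofLex j).2).val (base ⁻¹' X ∩ I.indist i t k) = ⊥ := by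
  obtain ⟨m, s⟩ := j
  change (I.component i m s).val _ = ⊥
  by_cases h : tag s m ∈ I.indist i t k
  · rw [component_val_inter_indist hsync hrec hcons hk h]
    obtain ⟨hs, hkm⟩ := (mem_indist_iff_of_le_life hk).1 h
    have hsame : (I.runSpace i t.base k).Same (I.runSpace i s k) :=
      ((hpers.same_iff_same_zero hrec hs).2 hj.1).map _
    rw [hsame.val_eq_bot_iff] at hX
    induction m using ENat.recTopCoe with
    | top =>
      exact (component_top_val_eq_bot_iff i s _).2 fun hsX =>
        (hj.2 rfl).runSpace_val_ne_bot i k hsX hX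
    | coe m =>
      exact (component_coe_val_eq_bot_iff i m s _).2
        (hcoh.runSpace_val_eq_bot (Nat.cast_le.1 hkm) hX)
  · exact component_val_inter_indist_eq_bot hsync hrec hcons hk h _

theorem exists_first_mem_indist {i : Fin n} {t : I.TaggedRun} {k : ℕ}
    (hk : (k : ℕ∞) ≤ t.life) :
    ∃ s : I.Run, (I.pl i (t.base, 0)).Same (I.pl i (s, 0)) ∧ tag s k ∈ I.indist i t k ∧
      ∀ j ∈ I.indices i t.base, j < toLex ((k : ℕ∞), s) →
        tag (ofLex j).2 (ofLex j).1 ∉ I.indist i t k := by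
  simp only [mem_indist_iff_of_le_life hk]
  obtain ⟨s, hs⟩ := exists_minimal_of_wellFoundedLT (fun s : I.Run =>
    (I.pl i (t.base, 0)).Same (I.pl i (s, 0)) ∧ (s, k) ∈ I.poss i (t.base, k))
    ⟨t.base, .refl _, rfl⟩
  refine ⟨s, hs.prop.1, ⟨hs.prop.2, le_rfl⟩, fun j hj hlt ⟨hjk, hkj⟩ => ?_⟩
  obtain hlife | ⟨-, hrun⟩ := Prod.Lex.lt_iff.1 hlt
  · exact hlife.not_ge hkj
  · exact hs.not_prop_of_lt hrun ⟨hj.1, hjk⟩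

/- The components that precede the first indistinguishable one do not survive conditioning, and
that one has lifetime `k`, so by PERSIST it is the space of `I` at the present point. -/
theorem tagged_runSpace_val_le_iff (hcoh : I.Coherent) (hsync : I.Synchronous)
    (hrec : I.PerfectRecall) (hcons : I.CONS) (hpers : I.PERSIST) {i : Fin n} {t : I.TaggedRun}
    {k : ℕ} (hk : (k : ℕ∞) ≤ t.life) {A B : Set I.TaggedRun} {X Y : Set I.Run}
    (hA : ∀ t' : I.TaggedRun, (k : ℕ∞) ≤ t'.life → (t' ∈ A ↔ t'.base ∈ X))
    (hB : ∀ t' : I.TaggedRun, (k : ℕ∞) ≤ t'.life → (t' ∈ B ↔ t'.base ∈ Y)) :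
    (I.tagged.runSpace i t k).val A ≤ (I.tagged.runSpace i t k).val B ↔
      (I.runSpace i t.base k).val X ≤ (I.runSpace i t.base k).val Y := by
  have inter_indist_eq {A : Set I.TaggedRun} {X : Set I.Run}
      (hA : ∀ t' : I.TaggedRun, (k : ℕ∞) ≤ t'.life → (t' ∈ A ↔ t'.base ∈ X)) :
      A ∩ I.indist i t k = base ⁻¹' X ∩ I.indist i t k := Set.ext fun t' =>
    and_congr_left fun h => hA t' ((mem_indist_iff_of_le_life hk).1 h).2
  have prior_val_le_iff : (I.tagged.runSpace i t k).val A ≤ (I.tagged.runSpace i t k).val B ↔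
      (I.prior i t.base).val (A ∩ I.indist i t k) ≤
        (I.prior i t.base).val (B ∩ I.indist i t k) :=
    (map_val_le_iff _ _ A B).trans (tagged_val_le_iff i t k _ _)
  obtain ⟨s, hs, hind, hfirst⟩ := exists_first_mem_indist (i := i) hk
  have hsame : (I.runSpace i t.base k).Same (I.runSpace i s k) :=
    ((hpers.same_iff_same_zero hrec ((mem_indist_iff_of_le_life hk).1 hind).1).2 hs).map _
  have restrict := component_val_inter_indist hsync hrec hcons hk hind
  rw [prior_val_le_iff, inter_indist_eq hA, inter_indist_eq hB, hsame.val_le_iff]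
  have earlier_eq_bot (X : Set I.Run) (j : I.indices i t.base)
      (hj : j < ⟨toLex ((k : ℕ∞), s), hs, fun h => absurd h (ENat.natCast_ne_top k)⟩) :
      (I.component i (ofLex j.1).1 (ofLex j.1).2).val (base ⁻¹' X ∩ I.indist i t k) = ⊥ :=
    component_val_inter_indist_eq_bot hsync hrec hcons hk (hfirst j.1 j.2 hj) _
  refine (lexSum_val_le_iff_of_eq_bot (earlier_eq_bot X) (earlier_eq_bot Y) fun h j =>
    component_val_eq_bot_of_runSpace_val_eq_bot hcoh hsync hrec hcons hpers hk ?_ j.2).trans ?_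
  · exact (hsame.val_eq_bot_iff X).2
      ((component_coe_val_eq_bot_iff i k s _).1 ((restrict _).symm.trans h))
  · change (I.component i k s).val _ ≤ (I.component i k s).val _ ↔ _
    rw [restrict, restrict]
    exact map_val_le_iff _ _ _ _

theorem tagged_sat_know_iff (hsync : I.Synchronous) {i : Fin n} {t : I.TaggedRun} {k : ℕ}
    (hk : (k : ℕ∞) ≤ t.life) {φ : Formula n Φ}
    (hφ : ∀ t' : I.TaggedRun, (k : ℕ∞) ≤ t'.life →
      (I.tagged.Sat (t', k) φ ↔ I.Sat (t'.base, k) φ)) :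
    I.tagged.Sat (t, k) (.know i φ) ↔ I.Sat (t.base, k) (.know i φ) := by
  constructor
  · rintro h ⟨s, l⟩ hs
    obtain rfl : k = l := hsync i _ _ hs
    refine (hφ (tag s ⊤) le_top).1 (h _ ((mem_tagged_poss_iff i t _ k k).2 ?_))
    exact (mem_indist_iff_of_le_life hk).2 ⟨hs, le_top⟩
  · rintro h ⟨(t' : I.TaggedRun), l⟩ ht'
    obtain rfl : k = l := tagged_synchronous hsync i _ _ ht'
    obtain ⟨hposs, hlife⟩ :=
      (mem_indist_iff_of_le_life hk).1 ((mem_tagged_poss_iff i t t' k k).1 ht')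
    exact (hφ t' hlife).2 (h _ hposs)

theorem tagged_sat_cond_iff (hcoh : I.Coherent) (hsync : I.Synchronous)
    (hrec : I.PerfectRecall) (hcons : I.CONS) (hpers : I.PERSIST) {i : Fin n} {t : I.TaggedRun}
    {k : ℕ} (hk : (k : ℕ∞) ≤ t.life) {φ ψ : Formula n Φ}
    (hφ : ∀ t' : I.TaggedRun, (k : ℕ∞) ≤ t'.life →
      (I.tagged.Sat (t', k) φ ↔ I.Sat (t'.base, k) φ))
    (hψ : ∀ t' : I.TaggedRun, (k : ℕ∞) ≤ t'.life →
      (I.tagged.Sat (t', k) ψ ↔ I.Sat (t'.base, k) ψ)) :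
    I.tagged.Sat (t, k) (.cond i φ ψ) ↔ I.Sat (t.base, k) (.cond i φ ψ) := by
  have hand t' hlife := and_congr (hφ t' hlife) (hψ t' hlife)
  have hand_not t' hlife := and_congr (hφ t' hlife) (not_congr (hψ t' hlife))
  rw [sat_cond_iff (tagged_synchronous hsync) (tagged_prior hsync).cons,
    sat_cond_iff hsync hcons]
  refine or_congr ?_ ?_
  · rw [val_eq_bot_iff_le_val_empty, val_eq_bot_iff_le_val_empty]
    exact tagged_runSpace_val_le_iff hcoh hsync hrec hcons hpers hk hφ fun _ _ => Iff.rfl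
  · rw [lt_iff_le_not_ge, lt_iff_le_not_ge]
    exact and_congr (tagged_runSpace_val_le_iff hcoh hsync hrec hcons hpers hk hand_not hand)
      (not_congr (tagged_runSpace_val_le_iff hcoh hsync hrec hcons hpers hk hand hand_not))

theorem tagged_sat_prim_iff (t : I.TaggedRun) (k : ℕ) (a : Φ) :
    I.tagged.Sat (t, k) (.prim a) ↔ I.Sat (t.base, k) (.prim a) := by
  change I.val ((t.1 k).1.1.1.1 (t.1 k).1.1.2) a ↔ _
  rw [t.coe_eq]
  rfl

theorem tagged_sat_iff_of_timeFree (hcoh : I.Coherent) (hsync : I.Synchronous)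
    (hrec : I.PerfectRecall) (hcons : I.CONS) (hpers : I.PERSIST) {φ : Formula n Φ}
    (hφ : φ.TimeFree) (t : I.TaggedRun) {k : ℕ} (hk : (k : ℕ∞) ≤ t.life) :
    I.tagged.Sat (t, k) φ ↔ I.Sat (t.base, k) φ := by
  induction φ generalizing t with
  | prim a => exact tagged_sat_prim_iff t k a
  | neg φ ih => exact not_congr (ih hφ t hk)
  | conj φ ψ ihφ ihψ => exact and_congr (ihφ hφ.1 t hk) (ihψ hφ.2 t hk)
  | know i φ ih => exact tagged_sat_know_iff hsync hk (ih hφ)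
  | cond i φ ψ ihφ ihψ =>
    exact tagged_sat_cond_iff hcoh hsync hrec hcons hpers hk (ihφ hφ.1) (ihψ hφ.2)
  | next φ => exact hφ.elim

theorem tagged_sat_iff (hcoh : I.Coherent) (hsync : I.Synchronous) (hrec : I.PerfectRecall)
    (hcons : I.CONS) (hpers : I.PERSIST) {φ : Formula n Φ} (hφ : φ.TemporallyLinear) (r : I.Run)
    (m : ℕ) : I.tagged.Sat (tag r ⊤, m) φ ↔ I.Sat (r, m) φ := by
  induction φ generalizing m with
  | prim a => exact tagged_sat_prim_iff (tag r ⊤) m a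
  | neg φ ih => exact not_congr (ih hφ m)
  | conj φ ψ ihφ ihψ => exact and_congr (ihφ hφ.1 m) (ihψ hφ.2 m)
  | know i φ =>
    exact tagged_sat_iff_of_timeFree hcoh hsync hrec hcons hpers (φ := .know i φ) hφ (tag r ⊤)
      le_top
  | cond i φ ψ =>
    exact tagged_sat_iff_of_timeFree hcoh hsync hrec hcons hpers (φ := .cond i φ ψ) hφ (tag r ⊤)
      le_top
  | next φ ih => exact ih hφ (m + 1)

theorem tagged_holds (hcoh : I.Coherent) (hsync : I.Synchronous) (hrec : I.PerfectRecall)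
    (hcons : I.CONS) (hpers : I.PERSIST) {c : Condition} (h : I.Holds c) : I.tagged.Holds c := by
  cases c with
  | QUAL => exact tagged_qual h
  | NORM => exact tagged_norm hcoh hsync hcons h
  | REF => exact tagged_ref h
  | SDP => exact tagged_sdp hsync hrec h
  | UNIF => exact tagged_unif hsync hrec hcons hpers h
  | RANK => exact tagged_rank h

end InterpretedSystem

theorem mainTheorem9 {n : ℕ} {Φ : Type v} (𝒜 : Set Condition)
    (I : InterpretedSystem.{u, v} n Φ)
    (hcoh : I.Coherent) (hsync : I.Synchronous) (hrec : I.PerfectRecall)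
    (hcons : I.CONS) (hpers : I.PERSIST) (hA : ∀ c ∈ 𝒜, I.Holds c) :
    ∃ I' : InterpretedSystem.{u, v} n Φ,
      I'.Synchronous ∧ I'.PerfectRecall ∧ I'.PRIOR ∧ (∀ c ∈ 𝒜, I'.Holds c) ∧
      ∃ f : I.Run → I'.Run,
        ∀ φ : Formula n Φ, φ.TemporallyLinear →
          ∀ (r : I.Run) (m : ℕ), I.Sat (r, m) φ ↔ I'.Sat (f r, m) φ := by
  exact ⟨I.tagged, InterpretedSystem.tagged_synchronous hsync,
    InterpretedSystem.tagged_perfectRecall hrec, InterpretedSystem.tagged_prior hsync,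
    fun c hc => InterpretedSystem.tagged_holds hcoh hsync hrec hcons hpers (hA c hc),
    fun r => InterpretedSystem.TaggedRun.tag r ⊤, fun _ hφ r m =>
      (InterpretedSystem.tagged_sat_iff hcoh hsync hrec hcons hpers hφ r m).symm⟩
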